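/- Let $(\mathcal A,\varphi)$ be a $C^*$-probability space, i.e. a unital $C^*$-algebra with a state. For $n\ge 1$ let $(a^{(n)}_{ij})_{1\le j\le i\le n}$ be elements of $\mathcal A$ which are Boolean independent with respect to $\varphi$ up to taking adjoints (the non-unital $*$-subalgebras $\mathcal A_{ij}$ generated by the single elements $a^{(n)}_{ij}$ satisfy $\varphi(x_1\cdots x_m)=\varphi(x_1)\cdots\varphi(x_m)$ whenever each $x_s$ lies in one of these subalgebras and neighbouring factors are taken from subalgebras with different labels), and which satisfy $\varphi(a^{(n)}_{ij})=0$ for $j\le i$, $a^{(n)}_{ii}=(a^{(n)}_{ii})^*$, and $\varphi\big((a^{(n)}_{ij})^2\big)=0$ for $j<i$. No further relation between the variances $\varphi((a^{(n)}_{ii})^2)$, $\varphi(a^{(n)}_{ij}(a^{(n)}_{ij})^*)$, $\varphi((a^{(n)}_{ij})^*a^{(n)}_{ij})$ is assumed. Let $E_{ij}$ be the matrix units of $M_n(\mathbb C)$, put $e_{ii}=\frac1{2\sqrt n}E_{ii}$ and $e_{ij}=\frac1{\sqrt n}E_{ij}$ for $j<i$, and let $$A_n=\sum_{1\le j\le i\le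 n}\big(e_{ij}\otimes a^{(n)}_{ij}+e_{ij}^*\otimes (a^{(n)}_{ij})^*\big)\in M_n(\mathbb C)\otimes\mathcal A=M_n(\mathcal A).$$ Suppose that there is a constant $C$ with $\|a^{(n)}_{ij}\|\le C$ for all $n$ and all $j\le i\le n$. Let $\eta_n(b)=(\mathrm{id}_n\otimes\varphi)[A_n(b\otimes 1)A_n]$ for $b\in M_n(\mathbb C)$, let $\mathrm{tr}_n$ be the normalized trace, and let $\rho_n$ be the distribution of the self-adjoint element $\eta_n(1)\in M_n(\mathbb C)\subset M_n(\mathcal A)$ with respect to $\mathrm{tr}_n\otimes\varphi$. (The distribution of a self-adjoint element $x$ with respect to a state $\psi$ is the probability measure $\nu$ on $\mathbb R$ with $\int f\,d\nu=\psi(f(x))$ for all continuous $f:\mathbb R\to\mathbb R$.) Suppose that $\rho_n$ converges weakly to a probability measure $\rho$ on $\mathbb R$. For a measure $\mu$ on $\mathbb R$ denote by $\mu^{(2)}$ its push-forward along $t\mapsto t^2$. Then there is a unique symmetric measure $\mu$ on $\mathbb R$ with $\mu^{(2)}=\rho$, it is a probability measure, and the distribution of $A_n$ with respect to $\mathrm{tr}_n\otimes\varphi$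 converges weakly to $\mu$ as $n\to\infty$. -/

import Mathlib

open scoped ComplexOrder

/-- Boolean independence, with respect to a linear functional `φ`, of a family of (possibly
non-unital) star subalgebras: `φ (x₁ ⋯ x_m) = φ x₁ ⋯ φ x_m` for every word whose letters `x_s`
are taken from the subalgebras with labels `i_s`, where neighbouring labels are distinct.
A word is a list of pairs (label, letter); the empty word only records `φ 1 = 1`. -/
def BooleanIndependent {A : Type*} [Ring A] [StarRing A] [Algebra ℂ A] [StarModule ℂ A]
    {ι : Type*} (φ : A →ₗ[ℂ] ℂ) (S : ι → NonUnitalStarSubalgebra ℂ A) : Prop :=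
  ∀ w : List (ι × A), w.IsChain (fun p q => p.1 ≠ q.1) → (∀ p ∈ w, p.2 ∈ S p.1) →
    φ (w.map Prod.snd).prod = (w.map (fun p => φ p.2)).prod

/-- The elementary tensor `e ⊗ x` in `M_n(ℂ) ⊗ A = M_n(A)`. -/
def elemTensor {A : Type*} [CStarAlgebra A] {n : ℕ} (e : Matrix (Fin n) (Fin n) ℂ) (x : A) :
    CStarMatrix (Fin n) (Fin n) A :=
  CStarMatrix.ofMatrix (Matrix.of fun k l => e k l • x)

/-- The conditional expectation `id_n ⊗ φ : M_n(A) → M_n(ℂ)`. -/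
noncomputable def idTensor {A : Type*} [CStarAlgebra A] (n : ℕ) (φ : A →ₗ[ℂ] ℂ) :
    CStarMatrix (Fin n) (Fin n) A →ₗ[ℂ] Matrix (Fin n) (Fin n) ℂ where
  toFun M := Matrix.of fun k l => φ (M k l)
  map_add' M N := by ext k l; simp
  map_smul' c M := by ext k l; simp

/-- The functional `tr_n ⊗ φ` on `M_n(A)`, where `tr_n` is the normalized trace. -/
noncomputable def trTensor {A : Type*} [CStarAlgebra A] (n : ℕ) (φ : A →ₗ[ℂ] ℂ) :
    CStarMatrix (Fin n) (Fin n) A →ₗ[ℂ] ℂ :=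
  ((n : ℂ)⁻¹) • (Matrix.traceLinearMap (Fin n) ℂ ℂ ∘ₗ idTensor n φ)

/-- The probability measure `μ` on `ℝ` is the distribution of the self-adjoint element `x` with
respect to the functional `ψ`: `∫ f dμ = ψ (f (x))` for every continuous `f : ℝ → ℝ`, where
`f (x)` is given by the continuous functional calculus. (If `x` is not self-adjoint then no `μ`
qualifies: all `f (x)` are then zero by convention, while `∫ 1 dμ = 1`.) -/
def IsDistribution {C : Type*} [CStarAlgebra C] (ψ : C →ₗ[ℂ] ℂ) (x : C)
    (μ : MeasureTheory.ProbabilityMeasure ℝ) : Prop :=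
  ∀ f : ℝ → ℝ, Continuous f →
    MeasureTheory.Integrable f (μ : MeasureTheory.Measure ℝ) ∧
      ((∫ t, f t ∂(μ : MeasureTheory.Measure ℝ) : ℝ) : ℂ) = ψ (cfc f x)

/-- The scaled matrix units `e_{ii} = E_{ii} / (2 √n)` and `e_{ij} = E_{ij} / √n` for `i ≠ j`. -/
noncomputable def scaledUnit (n : ℕ) (i j : Fin n) : Matrix (Fin n) (Fin n) ℂ :=
  if i = j then Matrix.single i i ((1 / (2 * Real.sqrt n) : ℝ) : ℂ)
  else Matrix.single i j ((1 / Real.sqrt n : ℝ) : ℂ)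

/-- The `n × n` Boolean Wigner matrix
`A_n = ∑_{j ≤ i} (e_{ij} ⊗ a_{ij} + e_{ij}^* ⊗ a_{ij}^*)`. -/
noncomputable def wignerMatrix {A : Type*} [CStarAlgebra A] {n : ℕ} (a : Fin n → Fin n → A) :
    CStarMatrix (Fin n) (Fin n) A :=
  ∑ i : Fin n, ∑ j ∈ Finset.univ.filter (fun j : Fin n => j ≤ i),
    (elemTensor (scaledUnit n i j) (a i j)
      + elemTensor (Matrix.conjTranspose (scaledUnit n i j)) (star (a i j)))

/-- The assumptions on the entries `a_{ij}`, `j ≤ i`, of a Boolean Wigner matrix (the values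
`a i j` with `i < j` play no role). No relation between the variances `φ (a_{ii} ^ 2)`,
`φ (a_{ij} a_{ij}^*)`, `φ (a_{ij}^* a_{ij})` is required. -/
structure IsBooleanWignerFamily {A : Type*} [CStarAlgebra A] {n : ℕ} (φ : A →ₗ[ℂ] ℂ)
    (a : Fin n → Fin n → A) : Prop where
  independent : BooleanIndependent φ
    (fun p : {p : Fin n × Fin n // p.2 ≤ p.1} =>
      NonUnitalStarAlgebra.adjoin ℂ ({a p.1.1 p.1.2} : Set A))
  centered : ∀ i j, j ≤ i → φ (a i j) = 0
  selfAdjoint_diag : ∀ i, IsSelfAdjoint (a i i)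
  sq_offDiag : ∀ i j, j < i → φ (a i j ^ 2) = 0

/-- The variance map `η(b) = (id_n ⊗ φ)[M b M]` of `M ∈ M_n(A)`, for `b ∈ M_n(ℂ)`, where `b` is
identified with `b ⊗ 1 ∈ M_n(A)`. -/
noncomputable def varianceMap {A : Type*} [CStarAlgebra A] {n : ℕ} (φ : A →ₗ[ℂ] ℂ)
    (M : CStarMatrix (Fin n) (Fin n) A) (b : Matrix (Fin n) (Fin n) ℂ) :
    Matrix (Fin n) (Fin n) ℂ :=
  idTensor n φ (M * elemTensor b 1 * M)

/-- A measure on `ℝ` is symmetric if it is invariant under `t ↦ -t`. -/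
def IsSymmetricMeasure (μ : MeasureTheory.Measure ℝ) : Prop :=
  μ.map (fun t => -t) = μ

/-- `μ^{(2)}`, the push-forward of `μ` along `t ↦ t ^ 2`. -/
noncomputable def squarePushforward (μ : MeasureTheory.Measure ℝ) : MeasureTheory.Measure ℝ :=
  μ.map (fun t => t ^ 2)

/-! In the GNS space of `φ`, with `Ω` the vector of `1`, Boolean independence forces `y x Ω = φ(x) y
Ω` for `x`, `y` in different algebras, because the difference has norm zero. Hence the last letter
`x` of a word factors out of `φ` whatever precedes `y` (`BooleanIndependent.apply_mul_mul`).

Let `B` be the Wigner matrix; its entries have norm at most `D = C/√n`. In `φ((B^(k+2))_ij)` the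
last letter `B_lj` is centered, so it survives only when preceded by its partner `B_jl`, which
leaves `∑_l φ((B^k)_ij B_jl B_lj)`. The pair `B_jl B_lj` factors out too, unless the letter before
it is `B_lj`; these exceptions add up to `O(n D³) = O(D)`. With `η_j` the `j`-th diagonal entry of
the diagonal matrix `η_n(1)`, this reads `φ((B^(k+2))_ij) = η_j φ((B^k)_ij) + O(D)`, with constants
independent of `n`. So diagonal entries of even powers `2k` have expectation close to `η_i^k`, those
of odd powers close to `0`, and averaging over `i` compares the moments of `A_n` with those of
`ρ_n`.

Since `0 ≤ η_i ≤ C²`, weak convergence of `ρ_n` gives convergence of its moments, and `ρ` lives on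
`[0, C²]`. The limiting moments are those of the average of the images of `ρ` under `±√t`, a
compactly supported measure, so the method of moments applies. Uniqueness holds because a symmetric
measure is the average of the laws of `|t|` and `-|t|`, both determined by the law of `t²`. -/

/-! ### States and Boolean independence -/

section PositiveFunctional

variable {A : Type*} [CStarAlgebra A] [PartialOrder A] [StarOrderedRing A] (φ : A →ₚ[ℂ] ℂ)

open scoped InnerProductSpace in
/-- A state is contractive. -/
theorem PositiveLinearMap.norm_apply_le_of_map_one (hφ : φ 1 = 1) (x : A) : ‖φ x‖ ≤ ‖x‖ := by
  have h1 : ‖φ.toPreGNS 1‖ = 1 := by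
    rw [φ.preGNS_norm_def]; simp [hφ]
  have h2 : ‖φ.toPreGNS x‖ ≤ ‖x‖ := by
    have := (φ.leftMulMapPreGNS x).le_of_opNorm_le
      (LinearMap.mkContinuous_norm_le _ (norm_nonneg x) _) (φ.toPreGNS 1)
    simpa [h1] using this
  have h3 : φ x = ⟪φ.toPreGNS 1, φ.toPreGNS x⟫_ℂ := by
    rw [φ.preGNS_inner_def]; simp
  rw [h3]
  refine (norm_inner_le_norm _ _).trans ?_
  rw [h1, one_mul]
  exact h2

-- Cauchy–Schwarz: the GNS vector of `z` is null, hence orthogonal to that of `star w`.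
open scoped InnerProductSpace in
theorem PositiveLinearMap.apply_mul_eq_zero {z : A} (hz : φ (star z * z) = 0) (w : A) :
    φ (w * z) = 0 := by
  have h1 : ‖φ.toPreGNS z‖ = 0 := by
    rw [φ.preGNS_norm_def]; simp [hz]
  have h3 : φ (w * z) = ⟪φ.toPreGNS (star w), φ.toPreGNS z⟫_ℂ := by
    rw [φ.preGNS_inner_def]; simp
  rw [h3, ← norm_eq_zero]
  refine le_antisymm ((norm_inner_le_norm _ _).trans ?_) (norm_nonneg _)
  rw [h1, mul_zero]

/-- The rightmost letter of a word factors out of `φ`, whatever the beginning of the word is. -/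
theorem BooleanIndependent.apply_mul_mul {ι : Type*} {S : ι → NonUnitalStarSubalgebra ℂ A}
    {φ : A →ₚ[ℂ] ℂ} (hS : BooleanIndependent φ.toLinearMap S) {p q : ι} (hpq : p ≠ q) {x y : A}
    (hx : x ∈ S p) (hy : y ∈ S q) (w : A) : φ (w * y * x) = φ x * φ (w * y) := by
  have two : ∀ {p q : ι}, p ≠ q → ∀ {x y : A}, x ∈ S p → y ∈ S q → φ (y * x) = φ y * φ x := by
    intro p q hpq x y hx hy
    have := hS [(q, y), (p, x)] (by simpa using hpq.symm) (by simp [hx, hy])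
    simpa using this
  have three : φ (star x * (star y * y) * x) = φ (star x) * φ (star y * y) * φ x := by
    have := hS [(p, star x), (q, star y * y), (p, x)] (by simpa using ⟨hpq, hpq.symm⟩)
      (by simp [hx, star_mem hx, mul_mem (star_mem hy) hy])
    simpa [mul_assoc] using this
  have hyy := mul_mem (star_mem hy) hy
  have e1 := two hpq hx hyy
  have e2 := two hpq.symm hyy (star_mem hx)
  -- All four terms of the expansion are alternating words in `x`, `star y * y` and `star x`, each
  -- equal to `|φ x|² φ (star y * y)` up to sign, and they cancel.
  have hz : φ (star (y * x - φ x • y) * (y * x - φ x • y)) = 0 := by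
    have : star (y * x - φ x • y) * (y * x - φ x • y)
        = star x * (star y * y) * x - φ x • (star x * (star y * y))
          - star (φ x) • ((star y * y) * x) + (φ x * star (φ x)) • (star y * y) := by
      simp only [star_sub, star_mul, star_smul, sub_mul, mul_sub, smul_mul_assoc, mul_smul_comm,
        smul_smul, mul_assoc, smul_sub]
      abel_nf
    rw [this]
    simp only [map_add, map_sub, map_smul, three, e1, e2, smul_eq_mul, map_star]
    ring
  have := φ.apply_mul_eq_zero hz w
  rw [mul_sub, map_sub, mul_smul_comm, map_smul, sub_eq_zero] at this
  rw [mul_assoc, this, smul_eq_mul]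

end PositiveFunctional

/-! ### Moments of matrices with Boolean independent entries -/

section BooleanMatrix

set_option linter.unusedSectionVars false

variable {A : Type*} [CStarAlgebra A] [PartialOrder A] [StarOrderedRing A]
  {ι m : Type*} [Fintype m] [DecidableEq m]

/-- The entries of a matrix over `A` are centered, bounded by `D`, and taken from Boolean
independent subalgebras; the labels at positions of one column are distinct, and transposed
positions have the same label. -/
structure IsBooleanMatrix (φ : A →ₚ[ℂ] ℂ) (S : ι → NonUnitalStarSubalgebra ℂ A) (ℓ : m → m → ι)
    (D : ℝ) (B : CStarMatrix m m A) : Prop where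
  independent : BooleanIndependent φ.toLinearMap S
  symm : ∀ i j, ℓ i j = ℓ j i
  inj : ∀ {i k} j, ℓ i j = ℓ k j → i = k
  mem : ∀ i j, B i j ∈ S (ℓ i j)
  centered : ∀ i j, φ (B i j) = 0
  norm_le : ∀ i j, ‖B i j‖ ≤ D

variable {φ : A →ₚ[ℂ] ℂ} {S : ι → NonUnitalStarSubalgebra ℂ A} {ℓ : m → m → ι} {C D : ℝ}
  {B : CStarMatrix m m A}

namespace IsBooleanMatrix

/-- Split off the last factor `B r j` of the power. Labels within column `j` are distinct, so `x`
factors out for every `r` except `r = l`; the second term is the defect of that single summand. -/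
theorem apply_pow_succ_mul_centered (h : IsBooleanMatrix φ S ℓ D B) (k : ℕ) (i j l : m) {x : A}
    (hx : x ∈ S (ℓ l j)) :
    φ ((B ^ (k + 1)) i j * x) = φ x * φ ((B ^ (k + 1)) i j)
      + φ ((B ^ k) i l * (B l j * x - φ x • B l j)) := by
  have key : ∀ r, φ ((B ^ k) i r * B r j * x) = φ x * φ ((B ^ k) i r * B r j)
      + if r = l then φ ((B ^ k) i l * (B l j * x - φ x • B l j)) else 0 := by
    intro r
    split_ifs with hr
    · subst hr
      rw [mul_sub, map_sub, mul_smul_comm, map_smul, smul_eq_mul, mul_assoc]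
      ring
    · rw [add_zero]
      exact h.independent.apply_mul_mul (fun e => hr (h.inj j e).symm) hx (h.mem r j) _
  rw [pow_succ, CStarMatrix.mul_apply, Finset.sum_mul, map_sum, map_sum, Finset.mul_sum,
    Finset.sum_congr rfl fun r _ => key r, Finset.sum_add_distrib]
  simp

theorem mul_mem_label (h : IsBooleanMatrix φ S ℓ D B) (j l : m) : B j l * B l j ∈ S (ℓ l j) :=
  mul_mem (h.symm j l ▸ h.mem j l) (h.mem l j)

/-- The last letter `B l j` is centered, so only the words in which it follows its transposed
partner `B j l` contribute. -/
theorem apply_pow_add_two (h : IsBooleanMatrix φ S ℓ D B) (k : ℕ) (i j : m) :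
    φ ((B ^ (k + 2)) i j) = ∑ l, φ ((B ^ k) i j * (B j l * B l j)) := by
  rw [pow_succ, CStarMatrix.mul_apply, map_sum]
  refine Finset.sum_congr rfl fun l _ => ?_
  rw [h.apply_pow_succ_mul_centered k i l j (h.symm l j ▸ h.mem l j), h.centered]
  simp

theorem apply_one_mul (i j : m) (x : A) :
    φ ((1 : CStarMatrix m m A) i j * x) = if i = j then φ x else 0 := by
  rw [CStarMatrix.one_apply]
  split_ifs <;> simp

theorem apply_sq (h : IsBooleanMatrix φ S ℓ D B) (i j : m) :
    φ ((B ^ 2) i j) = if i = j then ∑ l, φ (B j l * B l j) else 0 := by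
  have := h.apply_pow_add_two 0 i j
  simp only [zero_add, pow_zero, apply_one_mul] at this
  rw [this]
  split_ifs <;> simp

end IsBooleanMatrix

/-- Bound for `φ ((B ^ k) i j * x)` with `‖x‖ ≤ 1`. -/
noncomputable def booleanBound (C : ℝ) : ℕ → ℝ
  | 0 => 1
  | 1 => C
  | k + 2 => C ^ 2 * booleanBound C k + 2 * C * booleanBound C (k + 1)

theorem booleanBound_nonneg (hC : 0 ≤ C) : ∀ k, 0 ≤ booleanBound C k
  | 0 => zero_le_one
  | 1 => hC
  | k + 2 => by
    have := booleanBound_nonneg hC k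
    have := booleanBound_nonneg hC (k + 1)
    rw [booleanBound]
    positivity

namespace IsBooleanMatrix

theorem norm_mul_sub_le (h : IsBooleanMatrix φ S ℓ D B) (hφ : φ 1 = 1) (i j : m) (x : A) :
    ‖B i j * x - φ x • B i j‖ ≤ 2 * D * ‖x‖ := by
  have hx := φ.norm_apply_le_of_map_one hφ x
  have hB := h.norm_le i j
  have hD : 0 ≤ D := (norm_nonneg _).trans hB
  calc _ ≤ ‖B i j‖ * ‖x‖ + ‖φ x‖ * ‖B i j‖ :=
        (norm_sub_le _ _).trans (add_le_add (norm_mul_le _ _) (norm_smul_le _ _))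
    _ ≤ D * ‖x‖ + ‖x‖ * D := by gcongr
    _ = _ := by ring

theorem mul_sub_mem (h : IsBooleanMatrix φ S ℓ D B) (i j : m) {x : A} (hx : x ∈ S (ℓ i j)) :
    B i j * x - φ x • B i j ∈ S (ℓ i j) :=
  sub_mem (mul_mem (h.mem i j) hx) (SMulMemClass.smul_mem _ (h.mem i j))

theorem norm_mul_le_sq (h : IsBooleanMatrix φ S ℓ D B) (i j : m) : ‖B i j * B j i‖ ≤ D ^ 2 := by
  have hD : 0 ≤ D := (norm_nonneg _).trans (h.norm_le i j)
  rw [sq]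
  exact (norm_mul_le _ _).trans (mul_le_mul (h.norm_le _ _) (h.norm_le _ _) (norm_nonneg _) hD)

/-- The bound does not depend on the size of the matrix: the only sum over indices left by the
recursion has terms of order `D ^ 2`. The extra letter `x` is needed for the induction, since the
defect terms carry such a letter. -/
theorem norm_apply_pow_mul_le (h : IsBooleanMatrix φ S ℓ D B) (hφ : φ 1 = 1) (hC : 0 ≤ C)
    (hDC : D ≤ C) (hD : Fintype.card m * D ^ 2 ≤ C ^ 2) : ∀ (k : ℕ) (i j l : m) {x : A},
    x ∈ S (ℓ l j) → ‖φ ((B ^ k) i j * x)‖ ≤ booleanBound C k * ‖x‖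
  | 0, i, j, l, x, hx => by
    rw [pow_zero, apply_one_mul, booleanBound, one_mul]
    split_ifs
    · exact φ.norm_apply_le_of_map_one hφ x
    · simp
  | 1, i, j, l, x, hx => by
    rw [pow_one, booleanBound]
    refine (φ.norm_apply_le_of_map_one hφ _).trans ((norm_mul_le _ _).trans ?_)
    gcongr
    exact (h.norm_le i j).trans hDC
  | k + 2, i, j, l, x, hx => by
    have ih := h.norm_apply_pow_mul_le hφ hC hDC hD k
    have ih' := h.norm_apply_pow_mul_le hφ hC hDC hD (k + 1)
    have hk := booleanBound_nonneg hC k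
    have hk' := booleanBound_nonneg hC (k + 1)
    have h1 : ‖φ ((B ^ (k + 2)) i j)‖ ≤ C ^ 2 * booleanBound C k := by
      rw [h.apply_pow_add_two]
      calc _ ≤ ∑ r : m, booleanBound C k * D ^ 2 := by
            refine norm_sum_le_of_le _ fun r _ => (ih i j r (h.mul_mem_label j r)).trans ?_
            gcongr
            exact h.norm_mul_le_sq j r
        _ = booleanBound C k * (Fintype.card m * D ^ 2) := by
            rw [Finset.sum_const, Finset.card_univ, nsmul_eq_mul]; ring
        _ ≤ booleanBound C k * C ^ 2 := by gcongr
        _ = _ := mul_comm _ _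
    have h2 := ih' i l j (by rw [h.symm]; exact h.mul_sub_mem l j hx)
    rw [h.apply_pow_succ_mul_centered (k + 1) i j l hx]
    calc _ ≤ ‖φ x‖ * ‖φ ((B ^ (k + 2)) i j)‖
          + booleanBound C (k + 1) * ‖B l j * x - φ x • B l j‖ :=
          (norm_add_le _ _).trans (add_le_add (norm_mul_le _ _) h2)
      _ ≤ ‖x‖ * (C ^ 2 * booleanBound C k) + booleanBound C (k + 1) * (2 * C * ‖x‖) := by
          gcongr
          · exact φ.norm_apply_le_of_map_one hφ x
          · exact (h.norm_mul_sub_le hφ l j x).trans (by gcongr)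
      _ = _ := by rw [booleanBound]; ring

/-- Factoring `B j l * B l j` out leaves one defect for each `l`, of order `D ^ 3`; summing over `l`
absorbs `D ^ 2` into `C ^ 2` and keeps one factor `D`. -/
theorem norm_apply_pow_add_two_sub_le (h : IsBooleanMatrix φ S ℓ D B) (hφ : φ 1 = 1) (hC : 0 ≤ C)
    (hDC : D ≤ C) (hD : Fintype.card m * D ^ 2 ≤ C ^ 2) (k : ℕ) (i j : m) :
    ‖φ ((B ^ (k + 2)) i j) - (∑ l, φ (B j l * B l j)) * φ ((B ^ k) i j)‖
      ≤ 2 * C ^ 2 * booleanBound C (k - 1) * D := by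
  have hD0 : 0 ≤ D := (norm_nonneg _).trans (h.norm_le i j)
  have hk := booleanBound_nonneg hC (k - 1)
  rw [h.apply_pow_add_two, Finset.sum_mul, ← Finset.sum_sub_distrib]
  -- For `k = 0` the factorization is exact, so the truncated `k - 1` in the bound is harmless.
  cases k with
  | zero =>
    rw [Finset.sum_eq_zero, norm_zero]
    · positivity
    · intro l _
      have := apply_one_mul (φ := φ) i j 1
      rw [mul_one] at this
      rw [pow_zero, apply_one_mul, this]
      split_ifs <;> simp [hφ]
  | succ k =>
    simp only [Nat.add_sub_cancel] at hk ⊢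
    calc _ ≤ ∑ r : m, booleanBound C k * (2 * D * D ^ 2) := by
          refine norm_sum_le_of_le _ fun r _ => ?_
          rw [h.apply_pow_succ_mul_centered k i j r (h.mul_mem_label j r), add_sub_cancel_left]
          refine (h.norm_apply_pow_mul_le hφ hC hDC hD k i r j
            (by rw [h.symm]; exact h.mul_sub_mem r j (h.mul_mem_label j r))).trans ?_
          gcongr
          refine (h.norm_mul_sub_le hφ r j _).trans ?_
          gcongr
          exact h.norm_mul_le_sq j r
      _ = 2 * booleanBound C k * D * (Fintype.card m * D ^ 2) := by
          rw [Finset.sum_const, Finset.card_univ, nsmul_eq_mul]; ring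
      _ ≤ 2 * booleanBound C k * D * C ^ 2 := by gcongr
      _ = _ := by ring

theorem norm_sum_apply_le (h : IsBooleanMatrix φ S ℓ D B) (hφ : φ 1 = 1)
    (hD : Fintype.card m * D ^ 2 ≤ C ^ 2) (j : m) : ‖∑ l, φ (B j l * B l j)‖ ≤ C ^ 2 := by
  refine le_trans ?_ hD
  calc _ ≤ ∑ r : m, D ^ 2 := norm_sum_le_of_le _ fun r _ =>
        (φ.norm_apply_le_of_map_one hφ _).trans (h.norm_mul_le_sq j r)
    _ = _ := by rw [Finset.sum_const, Finset.card_univ, nsmul_eq_mul]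

/-- The even moments are powers of the variances, up to an error of the order of the entries. -/
theorem exists_norm_apply_pow_even_sub_le (C : ℝ) (hC : 0 ≤ C) (k : ℕ) : ∃ K : ℝ,
    ∀ {A : Type*} [CStarAlgebra A] [PartialOrder A] [StarOrderedRing A]
    {ι m : Type*} [Fintype m] [DecidableEq m] {φ : A →ₚ[ℂ] ℂ}
    {S : ι → NonUnitalStarSubalgebra ℂ A} {ℓ : m → m → ι} {D : ℝ} {B : CStarMatrix m m A},
    IsBooleanMatrix φ S ℓ D B → φ 1 = 1 → D ≤ C → Fintype.card m * D ^ 2 ≤ C ^ 2 → ∀ i,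
    ‖φ ((B ^ (2 * k)) i i) - (∑ l, φ (B i l * B l i)) ^ k‖ ≤ K * D := by
  induction k with
  | zero =>
    refine ⟨0, ?_⟩
    intro A _ _ _ ι m _ _ φ S ℓ D B h hφ hDC hD i
    simp [hφ]
  | succ k ih =>
    obtain ⟨K, hK⟩ := ih
    -- The new error of one recursion step, plus the old error multiplied by a variance of size at
    -- most `C ^ 2`. The constant depends on `C` and `k` only, so it serves all matrix sizes.
    refine ⟨2 * C ^ 2 * booleanBound C (2 * k - 1) + C ^ 2 * K, ?_⟩
    intro A _ _ _ ι m _ _ φ S ℓ D B h hφ hDC hD i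
    have h1 := h.norm_apply_pow_add_two_sub_le hφ hC hDC hD (2 * k) i i
    have h2 := hK h hφ hDC hD i
    have h3 := h.norm_sum_apply_le hφ hD i
    set η := ∑ l, φ (B i l * B l i)
    calc _ = ‖(φ ((B ^ (2 * k + 2)) i i) - η * φ ((B ^ (2 * k)) i i))
          + η * (φ ((B ^ (2 * k)) i i) - η ^ k)‖ := by
          congr 1
          rw [show 2 * (k + 1) = 2 * k + 2 by ring]
          ring
      _ ≤ 2 * C ^ 2 * booleanBound C (2 * k - 1) * D + C ^ 2 * (K * D) := by
          refine (norm_add_le _ _).trans (add_le_add h1 ?_)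
          rw [norm_mul]
          gcongr
      _ = _ := by ring

/-- The odd moments are of the order of the entries. -/
theorem exists_norm_apply_pow_odd_le (C : ℝ) (hC : 0 ≤ C) (k : ℕ) : ∃ K : ℝ,
    ∀ {A : Type*} [CStarAlgebra A] [PartialOrder A] [StarOrderedRing A]
    {ι m : Type*} [Fintype m] [DecidableEq m] {φ : A →ₚ[ℂ] ℂ}
    {S : ι → NonUnitalStarSubalgebra ℂ A} {ℓ : m → m → ι} {D : ℝ} {B : CStarMatrix m m A},
    IsBooleanMatrix φ S ℓ D B → φ 1 = 1 → D ≤ C → Fintype.card m * D ^ 2 ≤ C ^ 2 → ∀ i,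
    ‖φ ((B ^ (2 * k + 1)) i i)‖ ≤ K * D := by
  induction k with
  | zero =>
    refine ⟨0, ?_⟩
    intro A _ _ _ ι m _ _ φ S ℓ D B h hφ hDC hD i
    simp [h.centered]
  | succ k ih =>
    obtain ⟨K, hK⟩ := ih
    refine ⟨2 * C ^ 2 * booleanBound C (2 * k + 1 - 1) + C ^ 2 * K, ?_⟩
    intro A _ _ _ ι m _ _ φ S ℓ D B h hφ hDC hD i
    have h1 := h.norm_apply_pow_add_two_sub_le hφ hC hDC hD (2 * k + 1) i i
    have h2 := hK h hφ hDC hD i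
    have h3 := h.norm_sum_apply_le hφ hD i
    set η := ∑ l, φ (B i l * B l i)
    calc _ = ‖(φ ((B ^ (2 * k + 1 + 2)) i i) - η * φ ((B ^ (2 * k + 1)) i i))
          + η * φ ((B ^ (2 * k + 1)) i i)‖ := by
          congr 1
          rw [show 2 * (k + 1) + 1 = 2 * k + 1 + 2 by ring]
          ring
      _ ≤ 2 * C ^ 2 * booleanBound C (2 * k + 1 - 1) * D + C ^ 2 * (K * D) := by
          refine (norm_add_le _ _).trans (add_le_add h1 ?_)
          rw [norm_mul]
          gcongr
      _ = _ := by ring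

end IsBooleanMatrix

end BooleanMatrix

/-! ### Entries and variances of the Boolean Wigner matrix -/

section WignerMatrix

variable {A : Type*} [CStarAlgebra A] {n : ℕ}

theorem CStarMatrix.finset_sum_apply {m ι : Type*} {A : Type*} [AddCommMonoid A] (s : Finset ι)
    (f : ι → CStarMatrix m m A) (k l : m) : (∑ i ∈ s, f i) k l = ∑ i ∈ s, f i k l := by
  classical
  induction s using Finset.induction_on with
  | empty => simp
  | insert i s hi ih => rw [Finset.sum_insert hi, Finset.sum_insert hi, CStarMatrix.add_apply, ih]

/-- The entries of a Boolean Wigner matrix are the `a_{ij}` and their adjoints, scaled. -/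
theorem wignerMatrix_apply (a : Fin n → Fin n → A) (ha : ∀ i, IsSelfAdjoint (a i i))
    (k l : Fin n) : wignerMatrix a k l =
      ((1 / Real.sqrt n : ℝ) : ℂ) • if l ≤ k then a k l else star (a l k) := by
  have hterm : ∀ i j : Fin n, j ≤ i → (elemTensor (scaledUnit n i j) (a i j)
      + elemTensor (Matrix.conjTranspose (scaledUnit n i j)) (star (a i j))) k l =
      (if i = k ∧ j = l then ((1 / Real.sqrt n : ℝ) : ℂ) • a k l else 0)
      + (if i = l ∧ j = k ∧ j ≠ i then ((1 / Real.sqrt n : ℝ) : ℂ) • star (a l k) else 0) := by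
    intro i j hij
    rw [CStarMatrix.add_apply]
    simp only [elemTensor, CStarMatrix.ofMatrix_apply, Matrix.of_apply, scaledUnit]
    by_cases h : i = j
    · subst h
      simp only [if_true, Matrix.conjTranspose_apply, Matrix.single_apply, ne_eq, not_true,
        and_false, if_false, add_zero]
      by_cases h' : i = k ∧ i = l
      · obtain ⟨rfl, rfl⟩ := h'
        -- On the diagonal the two terms coincide, and their weights `1 / (2√n)` add up to `1 / √n`.
        simp only [and_self, if_true, (ha i).star_eq, ← add_smul]
        congr 1
        simp only [RCLike.star_def, Complex.conj_ofReal]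
        rw [← Complex.ofReal_add]
        congr 1
        field_simp
        norm_num
      · rw [if_neg h', if_neg h', if_neg (by tauto)]
        simp
    · simp only [if_neg h, Matrix.conjTranspose_apply, Matrix.single_apply]
      by_cases h1 : i = k ∧ j = l
      · obtain ⟨rfl, rfl⟩ := h1
        have : ¬ (i = j ∧ j = i) := by tauto
        simp [this]
      · by_cases h2 : i = l ∧ j = k
        · obtain ⟨rfl, rfl⟩ := h2
          simp [Ne.symm h, Complex.conj_ofReal]
        · have h3 : ¬ (i = l ∧ j = k ∧ j ≠ i) := by tauto
          simp [h1, h2, h3]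
  rw [wignerMatrix, CStarMatrix.finset_sum_apply]
  simp only [CStarMatrix.finset_sum_apply]
  simp only [Finset.sum_filter]
  have : ∀ i j : Fin n, (if j ≤ i then (elemTensor (scaledUnit n i j) (a i j)
      + elemTensor (Matrix.conjTranspose (scaledUnit n i j)) (star (a i j))) k l else 0) =
      (if i = k then if j = l then if l ≤ k then ((1 / Real.sqrt n : ℝ) : ℂ) • a k l else 0
        else 0 else 0)
      + (if i = l then if j = k then if k < l then ((1 / Real.sqrt n : ℝ) : ℂ) • star (a l k) else 0
        else 0 else 0) := by
    intro i j
    by_cases h : j ≤ i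
    · rw [if_pos h, hterm i j h]
      congr 1
      · by_cases h1 : i = k
        · by_cases h2 : j = l
          · subst h1 h2; simp [h]
          · simp [h1, h2]
        · simp [h1]
      · by_cases h1 : i = l
        · by_cases h2 : j = k
          · subst h1 h2; simp [h.lt_iff_ne]
          · simp [h1, h2]
        · simp [h1]
    · rw [if_neg h]
      have h1 : ¬ (i = k ∧ j = l ∧ l ≤ k) := by rintro ⟨rfl, rfl, h'⟩; exact h h'
      have h2 : ¬ (i = l ∧ j = k ∧ k < l) := by rintro ⟨rfl, rfl, h'⟩; exact h h'.le
      simp only [← ite_and, h1, h2, if_false, add_zero]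
  rw [Finset.sum_congr rfl fun i _ => Finset.sum_congr rfl fun j _ => this i j]
  simp only [Finset.sum_add_distrib, Finset.sum_ite_irrel, Finset.sum_ite_eq', Finset.sum_const_zero,
    Finset.mem_univ, if_true]
  by_cases h : l ≤ k
  · simp [h, not_lt.mpr h]
  · simp [h, not_le.mp h]

theorem isSelfAdjoint_wignerMatrix (a : Fin n → Fin n → A) : IsSelfAdjoint (wignerMatrix a) := by
  have h : ∀ (e : Matrix (Fin n) (Fin n) ℂ) (x : A),
      star (elemTensor e x) = elemTensor (Matrix.conjTranspose e) (star x) := by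
    intro e x
    ext k l
    simp [elemTensor, CStarMatrix.star_apply, star_smul]
  rw [IsSelfAdjoint, wignerMatrix, star_sum]
  refine Finset.sum_congr rfl fun i _ => ?_
  rw [star_sum]
  refine Finset.sum_congr rfl fun j _ => ?_
  rw [star_add, h, h, Matrix.conjTranspose_conjTranspose, star_star, add_comm]

/-- The label of the algebra that contains the `(k, l)` entry of a Boolean Wigner matrix. -/
def wignerLabel (k l : Fin n) : {p : Fin n × Fin n // p.2 ≤ p.1} :=
  ⟨(max k l, min k l), min_le_max⟩

theorem elemTensor_one_one : elemTensor (1 : Matrix (Fin n) (Fin n) ℂ) (1 : A) = 1 := by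
  ext k l
  rw [CStarMatrix.one_apply]
  simp only [elemTensor, CStarMatrix.ofMatrix_apply, Matrix.of_apply, Matrix.one_apply]
  split_ifs <;> simp

variable [PartialOrder A] [StarOrderedRing A]

theorem IsBooleanWignerFamily.isBooleanMatrix {φ : A →ₚ[ℂ] ℂ} {a : Fin n → Fin n → A}
    (ha : IsBooleanWignerFamily φ.toLinearMap a) {C : ℝ} (hC : ∀ i j, j ≤ i → ‖a i j‖ ≤ C) :
    IsBooleanMatrix φ (fun p : {p : Fin n × Fin n // p.2 ≤ p.1} =>
      NonUnitalStarAlgebra.adjoin ℂ ({a p.1.1 p.1.2} : Set A)) wignerLabel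
      (1 / Real.sqrt n * C) (wignerMatrix a) where
  independent := ha.independent
  symm i j := by simp [wignerLabel, max_comm, min_comm]
  inj {i k} j h := by
    simp only [wignerLabel, Subtype.mk.injEq, Prod.mk.injEq] at h
    grind
  mem i j := by
    rw [wignerMatrix_apply a ha.selfAdjoint_diag]
    refine SMulMemClass.smul_mem _ ?_
    split_ifs with h
    · simp only [wignerLabel, max_eq_left h, min_eq_right h]
      exact NonUnitalStarAlgebra.subset_adjoin ℂ _ rfl
    · have h' := (not_le.mp h).le
      simp only [wignerLabel, max_eq_right h', min_eq_left h']
      exact star_mem (NonUnitalStarAlgebra.subset_adjoin ℂ _ rfl)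
  centered i j := by
    have hc : ∀ i j, j ≤ i → φ (a i j) = 0 := ha.centered
    rw [wignerMatrix_apply a ha.selfAdjoint_diag, map_smul]
    split_ifs with h
    · rw [hc i j h, smul_zero]
    · rw [map_star, hc j i (not_le.mp h).le, star_zero, smul_zero]
  norm_le i j := by
    rw [wignerMatrix_apply a ha.selfAdjoint_diag, norm_smul, Complex.norm_real,
      Real.norm_of_nonneg (by positivity)]
    gcongr
    split_ifs with h
    · exact hC i j h
    · rw [norm_star]; exact hC j i (not_le.mp h).le

/-- The diagonal entries of `η(1)`. -/
noncomputable def wignerVariance (φ : A →ₚ[ℂ] ℂ) (a : Fin n → Fin n → A) (i : Fin n) : ℝ :=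
  ∑ l, (φ (wignerMatrix a i l * wignerMatrix a l i)).re

theorem apply_wignerMatrix_mul_nonneg (φ : A →ₚ[ℂ] ℂ) (a : Fin n → Fin n → A) (i l : Fin n) :
    0 ≤ φ (wignerMatrix a i l * wignerMatrix a l i) := by
  rw [← (isSelfAdjoint_wignerMatrix a).star_eq, CStarMatrix.star_apply]
  simp only [(isSelfAdjoint_wignerMatrix a).star_eq]
  exact φ.map_nonneg (star_mul_self_nonneg _)

theorem ofReal_wignerVariance (φ : A →ₚ[ℂ] ℂ) (a : Fin n → Fin n → A) (i : Fin n) :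
    (wignerVariance φ a i : ℂ) = ∑ l, φ (wignerMatrix a i l * wignerMatrix a l i) := by
  rw [wignerVariance, Complex.ofReal_sum]
  refine Finset.sum_congr rfl fun l _ => ?_
  have h := apply_wignerMatrix_mul_nonneg φ a i l
  exact (Complex.eq_re_of_ofReal_le (r := 0) (by simpa using h)).symm

theorem wignerVariance_nonneg (φ : A →ₚ[ℂ] ℂ) (a : Fin n → Fin n → A) (i : Fin n) :
    0 ≤ wignerVariance φ a i := by
  refine Finset.sum_nonneg fun l _ => ?_
  have h := apply_wignerMatrix_mul_nonneg φ a i l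
  exact (Complex.nonneg_iff.mp h).1

/-- Off the diagonal, the products `B i l * B l j` pair centered letters with different labels, so
their expectations vanish. -/
theorem IsBooleanWignerFamily.varianceMap_one {φ : A →ₚ[ℂ] ℂ} {a : Fin n → Fin n → A}
    (ha : IsBooleanWignerFamily φ.toLinearMap a) {C : ℝ} (hC : ∀ i j, j ≤ i → ‖a i j‖ ≤ C) :
    varianceMap φ.toLinearMap (wignerMatrix a) 1
      = Matrix.diagonal fun i => (wignerVariance φ a i : ℂ) := by
  have h := (ha.isBooleanMatrix hC).apply_sq
  ext i j
  rw [varianceMap, elemTensor_one_one, mul_one, ← sq, Matrix.diagonal_apply]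
  simp only [ofReal_wignerVariance]
  refine (h i j).trans ?_
  split_ifs with hij
  · rw [hij]
  · rfl

end WignerMatrix

/-! ### Existence of distributions; distributions of diagonal matrices -/

section Distribution

open MeasureTheory
open scoped CompactlySupported

/-- A unital functional that is nonnegative on squares of a `C*`-algebra has a spectral
distribution at every self-adjoint element. -/
theorem exists_isDistribution {C : Type*} [CStarAlgebra C] (ψ : C →ₗ[ℂ] ℂ)
    (hψ : ∀ x, 0 ≤ ψ (star x * x)) (hψ1 : ψ 1 = 1) {x : C} (hx : IsSelfAdjoint x) :
    ∃ μ : ProbabilityMeasure ℝ, IsDistribution ψ x μ := by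
  have hsq : ∀ f : C(spectrum ℝ x, ℝ), 0 ≤ f → 0 ≤ ψ (cfcHom hx f) := by
    intro f hf
    let g : C(spectrum ℝ x, ℝ) := ⟨fun t => Real.sqrt (f t), by fun_prop⟩
    have : f = star g * g := by
      ext t
      simp only [ContinuousMap.mul_apply, star_trivial]
      exact (Real.mul_self_sqrt (hf t)).symm
    rw [this, map_mul, map_star]
    exact hψ _
  have hreal : ∀ f : C(spectrum ℝ x, ℝ), (((ψ (cfcHom hx f)).re : ℝ) : ℂ) = ψ (cfcHom hx f) := by
    intro f
    -- A difference of two nonnegative functions, on which positivity already makes `ψ` real.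
    have h : f = f ⊔ 0 - (f ⊔ 0 - f) := by abel
    have h1 := Complex.nonneg_iff.mp (hsq (f ⊔ 0) le_sup_right)
    have h2 := Complex.nonneg_iff.mp (hsq (f ⊔ 0 - f) (sub_nonneg.mpr le_sup_left))
    apply Complex.ext
    · simp
    · rw [h, map_sub, map_sub, Complex.sub_im, ← h1.2, ← h2.2]
      simp
  let Λ₀ : C_c(spectrum ℝ x, ℝ) →ₗ[ℝ] ℝ :=
    { toFun f := (ψ (cfcHom hx f.toContinuousMap)).re
      map_add' f g := by
        rw [← Complex.add_re, ← map_add, ← map_add]; rfl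
      map_smul' c f := by
        have : (c • f).toContinuousMap = c • f.toContinuousMap := rfl
        rw [this, map_smul, LinearMap.map_smul_of_tower]
        simp }
  let Λ : C_c(spectrum ℝ x, ℝ) →ₚ[ℝ] ℝ := PositiveLinearMap.mk₀ Λ₀ fun f hf =>
    (Complex.nonneg_iff.mp (hsq f.toContinuousMap hf)).1
  let ν : Measure (spectrum ℝ x) := RealRMK.rieszMeasure Λ
  have hν : ∀ f : C(spectrum ℝ x, ℝ), ((∫ t, f t ∂ν : ℝ) : ℂ) = ψ (cfcHom hx f) := by
    intro f
    rw [← hreal]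
    congr 1
    -- The spectrum is compact, so Riesz–Markov covers all continuous functions on it.
    exact RealRMK.integral_rieszMeasure Λ (CompactlySupportedContinuousMap.continuousMapEquiv f)
  have : IsProbabilityMeasure ν := by
    have h := hν 1
    simp only [map_one, hψ1, ContinuousMap.one_apply, integral_const, smul_eq_mul, mul_one] at h
    constructor
    have h' : ν.real Set.univ = 1 := by exact_mod_cast h
    rwa [Measure.real, ENNReal.toReal_eq_one_iff] at h'
  refine ⟨⟨ν.map Subtype.val, Measure.isProbabilityMeasure_map (by fun_prop)⟩, fun f hf => ?_⟩
  have hm : AEMeasurable (Subtype.val : spectrum ℝ x → ℝ) ν := by fun_prop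
  have hr : Continuous fun t : spectrum ℝ x => f t := by fun_prop
  constructor
  · change Integrable f (ν.map Subtype.val)
    rw [integrable_map_measure hf.aestronglyMeasurable hm]
    exact hr.integrable_of_hasCompactSupport (HasCompactSupport.of_compactSpace _)
  · change ((∫ t, f t ∂(ν.map Subtype.val) : ℝ) : ℂ) = _
    rw [integral_map hm hf.aestronglyMeasurable, cfc_apply f x hx hf.continuousOn]
    exact hν ⟨_, hr⟩

theorem IsDistribution.integral_pow {C : Type*} [CStarAlgebra C] {ψ : C →ₗ[ℂ] ℂ} {x : C}
    {μ : ProbabilityMeasure ℝ} (h : IsDistribution ψ x μ) (hx : IsSelfAdjoint x) (k : ℕ) :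
    ((∫ t, t ^ k ∂(μ : Measure ℝ) : ℝ) : ℂ) = ψ (x ^ k) := by
  rw [(h (fun t => t ^ k) (by fun_prop)).2, cfc_pow_id x k hx]

/-- The spectrum lies in the finite set of values of `d`, where any `f` agrees with its Lagrange
interpolation polynomial; homomorphisms commute with polynomials. -/
theorem StarAlgHom.cfc_apply_ofReal {C : Type*} [CStarAlgebra C] {n : ℕ}
    (h : (Fin n → ℂ) →⋆ₐ[ℂ] C) (d : Fin n → ℝ) (f : ℝ → ℝ) :
    cfc f (h fun i => (d i : ℂ)) = h fun i => (f (d i) : ℂ) := by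
  have hd : IsSelfAdjoint (h fun i => (d i : ℂ)) := by
    refine IsSelfAdjoint.map (x := fun i => (d i : ℂ)) ?_ h
    ext i; simp
  let g : (Fin n → ℂ) →ₐ[ℝ] C := h.toAlgHom.restrictScalars ℝ
  let p : Polynomial ℝ := Lagrange.interpolate (Finset.univ.image d) id f
  have hp : ∀ i, p.eval (d i) = f (d i) := fun i =>
    Lagrange.eval_interpolate_at_node f (v := id) Function.injective_id.injOn
      (Finset.mem_image_of_mem d (Finset.mem_univ i))
  have hspec : Set.EqOn f p.eval (spectrum ℝ (h fun i => (d i : ℂ))) := by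
    intro t ht
    have h1 : t ∈ spectrum ℝ fun i => (d i : ℂ) := AlgHom.spectrum_apply_subset g _ ht
    rw [Pi.spectrum_eq, Set.mem_iUnion] at h1
    obtain ⟨i, hi⟩ := h1
    have h2 : spectrum ℝ (d i : ℂ) = {d i} := spectrum.scalar_eq (d i)
    rw [h2, Set.mem_singleton_iff] at hi
    rw [hi]
    exact (hp i).symm
  rw [cfc_congr hspec, cfc_polynomial p _ hd]
  refine (Polynomial.aeval_algHom_apply g (fun i => (d i : ℂ)) p).trans (congrArg h ?_)
  ext i
  rw [Polynomial.aeval_pi, AlgHom.pi_apply, ← hp i]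
  exact Polynomial.aeval_algebraMap_apply ℂ (d i) p

theorem IsDistribution.integral_eq_of_pi {C : Type*} [CStarAlgebra C] {n : ℕ} {ψ : C →ₗ[ℂ] ℂ}
    (h : (Fin n → ℂ) →⋆ₐ[ℂ] C) (d : Fin n → ℝ) {μ : ProbabilityMeasure ℝ}
    (hμ : IsDistribution ψ (h fun i => (d i : ℂ)) μ) (f : ℝ → ℝ) (hf : Continuous f) :
    ((∫ t, f t ∂(μ : Measure ℝ) : ℝ) : ℂ) = ψ (h fun i => (f (d i) : ℂ)) := by
  rw [(hμ f hf).2, h.cfc_apply_ofReal d f]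

variable {A : Type*} [CStarAlgebra A] {n : ℕ}

theorem trTensor_apply (φ : A →ₗ[ℂ] ℂ) (M : CStarMatrix (Fin n) (Fin n) A) :
    trTensor n φ M = (n : ℂ)⁻¹ * ∑ i, φ (M i i) := rfl

theorem trTensor_one (hn : 0 < n) {φ : A →ₗ[ℂ] ℂ} (hφ : φ 1 = 1) : trTensor n φ 1 = 1 := by
  have : (n : ℂ) ≠ 0 := by exact_mod_cast hn.ne'
  simp [trTensor_apply, hφ, this]

theorem trTensor_star_mul_self_nonneg [PartialOrder A] [StarOrderedRing A] (φ : A →ₚ[ℂ] ℂ)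
    (M : CStarMatrix (Fin n) (Fin n) A) : 0 ≤ trTensor n φ.toLinearMap (star M * M) := by
  rw [trTensor_apply]
  have hn : (0 : ℂ) ≤ (n : ℂ)⁻¹ := by
    rw [← Complex.ofReal_natCast, ← Complex.ofReal_inv]
    exact_mod_cast (by positivity : (0 : ℝ) ≤ (n : ℝ)⁻¹)
  refine mul_nonneg hn (Finset.sum_nonneg fun i _ => ?_)
  rw [CStarMatrix.mul_apply, map_sum]
  refine Finset.sum_nonneg fun j _ => ?_
  rw [CStarMatrix.star_apply]
  exact φ.map_nonneg (star_mul_self_nonneg _)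

theorem trTensor_elemTensor_diagonal {φ : A →ₗ[ℂ] ℂ} (hφ : φ 1 = 1) (d : Fin n → ℂ) :
    trTensor n φ (elemTensor (Matrix.diagonal d) 1) = (n : ℂ)⁻¹ * ∑ i, d i := by
  simp [trTensor_apply, elemTensor, hφ]

variable (A n) in
/-- Diagonal scalar matrices in `M_n(A)`. -/
def diagonalStarAlgHom : (Fin n → ℂ) →⋆ₐ[ℂ] CStarMatrix (Fin n) (Fin n) A where
  toFun d := elemTensor (Matrix.diagonal d) 1
  map_one' := by rw [Matrix.diagonal_one']; exact elemTensor_one_one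
  map_zero' := by ext; simp [elemTensor]
  map_add' d e := by
    ext k l
    simp only [elemTensor, CStarMatrix.add_apply, CStarMatrix.ofMatrix_apply, Matrix.of_apply,
      Matrix.diagonal_apply, Pi.add_apply]
    split_ifs <;> simp [add_smul]
  map_mul' d e := by
    ext k l
    rw [CStarMatrix.mul_apply]
    simp only [elemTensor, CStarMatrix.ofMatrix_apply, Matrix.of_apply,
      Matrix.diagonal_apply, Pi.mul_apply]
    simp only [ite_smul, zero_smul, mul_ite, mul_zero, ite_mul, zero_mul, smul_mul_smul_comm, mul_one]
    by_cases h : k = l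
    · subst h; simp
    · simp [h]
  commutes' r := by
    ext k l
    rw [CStarMatrix.algebraMap_apply]
    simp [elemTensor, Matrix.diagonal_apply, Algebra.algebraMap_eq_smul_one]
  map_star' d := by
    ext k l
    rw [CStarMatrix.star_apply]
    simp only [elemTensor, CStarMatrix.ofMatrix_apply, Matrix.of_apply,
      Matrix.diagonal_apply, Pi.star_apply]
    by_cases h : k = l
    · subst h; simp
    · simp [h, Ne.symm h]

variable [PartialOrder A] [StarOrderedRing A]

/-- The distribution of a real diagonal matrix is the empirical measure of its entries. -/
theorem IsDistribution.integral_eq_of_diagonal {φ : A →ₗ[ℂ] ℂ} (hφ : φ 1 = 1) {d : Fin n → ℝ}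
    {μ : ProbabilityMeasure ℝ} (h : IsDistribution (trTensor n φ)
      (elemTensor (Matrix.diagonal fun i => (d i : ℂ)) (1 : A)) μ) (f : ℝ → ℝ)
    (hf : Continuous f) : ∫ t, f t ∂(μ : Measure ℝ) = (n : ℝ)⁻¹ * ∑ i, f (d i) := by
  have h1 := IsDistribution.integral_eq_of_pi (diagonalStarAlgHom A n) d h f hf
  have h2 := trTensor_elemTensor_diagonal hφ fun i => (f (d i) : ℂ)
  apply Complex.ofReal_injective
  rw [h1.trans h2]
  push_cast
  rfl

end Distribution

/-! ### The method of moments -/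

section Moments

open MeasureTheory Filter Topology

/-- The method of moments, for a limit with compact support. -/
theorem tendsto_of_moments {μn : ℕ → ProbabilityMeasure ℝ} {μ : ProbabilityMeasure ℝ} {R : ℝ}
    (hR : 0 ≤ R) (hμ : ∀ᵐ t ∂(μ : Measure ℝ), |t| ≤ R)
    (hint : ∀ᶠ n in atTop, ∀ k : ℕ, Integrable (fun t => t ^ k) (μn n : Measure ℝ))
    (hmom : ∀ k : ℕ, Tendsto (fun n => ∫ t, t ^ k ∂(μn n : Measure ℝ)) atTop
      (𝓝 (∫ t, t ^ k ∂(μ : Measure ℝ)))) :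
    Tendsto μn atTop (𝓝 μ) := by
  have hμint : ∀ k : ℕ, Integrable (fun t => t ^ k) (μ : Measure ℝ) := fun k =>
    Integrable.of_bound (C := R ^ k) (by fun_prop) (hμ.mono fun t ht => by
      rw [norm_pow]; exact pow_le_pow_left₀ (norm_nonneg _) ht k)
  have hpolyint : ∀ {ν : Measure ℝ}, (∀ k : ℕ, Integrable (fun t => t ^ k) ν) →
      ∀ p : Polynomial ℝ, Integrable (fun t => p.eval t) ν := by
    intro ν h p
    simp only [Polynomial.eval_eq_sum_range]
    exact integrable_finsetSum _ fun k _ => (h k).const_mul _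
  have hpoly : ∀ p : Polynomial ℝ, Tendsto (fun n => ∫ t, p.eval t ∂(μn n : Measure ℝ)) atTop
      (𝓝 (∫ t, p.eval t ∂(μ : Measure ℝ))) := by
    intro p
    have hsum : ∀ {ν : Measure ℝ}, (∀ k : ℕ, Integrable (fun t => t ^ k) ν) →
        ∫ t, p.eval t ∂ν = ∑ k ∈ Finset.range (p.natDegree + 1), p.coeff k * ∫ t, t ^ k ∂ν := by
      intro ν h
      simp only [Polynomial.eval_eq_sum_range]
      rw [integral_finsetSum _ fun k _ => (h k).const_mul _]
      simp only [integral_const_mul]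
    rw [hsum hμint]
    refine Tendsto.congr' (hint.mono fun n hn => (hsum hn).symm) ?_
    exact tendsto_finsetSum _ fun k _ => (hmom k).const_mul _
  rw [ProbabilityMeasure.tendsto_iff_forall_integral_tendsto]
  intro f
  rw [Metric.tendsto_atTop']
  intro ε hε
  -- The margin beyond `R` makes `(t / (R + 1)) ^ (2 * N)` uniformly small on the support of `μ`,
  -- while it dominates `p` and `f` outside the interval. Since `K` below is uniform in `N`, a
  -- single `N` can be fixed before `n`, and convergence of the moment of order `2 * N` controls the
  -- tails of `μn n`. The final error is at most `5ε/8`.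
  obtain ⟨p, hp⟩ := exists_polynomial_near_of_continuousOn (-(R + 1)) (R + 1) f
    f.continuous.continuousOn (ε / 8) (by positivity)
  -- growth of the error outside of the interval
  obtain ⟨K, hK0, hK⟩ : ∃ K : ℝ, 0 ≤ K ∧ ∀ t : ℝ, R + 1 ≤ |t| → ∀ N, p.natDegree ≤ 2 * N →
      |p.eval t - f t| ≤ K * (t ^ 2 / (R + 1) ^ 2) ^ N := by
    refine ⟨(∑ k ∈ Finset.range (p.natDegree + 1), |p.coeff k| * (R + 1) ^ k) + ‖f‖,
      by positivity, fun t ht N hN => ?_⟩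
    have hs : 1 ≤ |t| / (R + 1) := by rwa [one_le_div (by positivity)]
    have hpow : (t ^ 2 / (R + 1) ^ 2) ^ N = (|t| / (R + 1)) ^ (2 * N) := by
      rw [pow_mul, div_pow |t|, sq_abs]
    rw [hpow, add_mul, Finset.sum_mul]
    refine (abs_sub _ _).trans (add_le_add ?_ ?_)
    · rw [Polynomial.eval_eq_sum_range]
      refine (Finset.abs_sum_le_sum_abs _ _).trans (Finset.sum_le_sum fun k hk => ?_)
      rw [abs_mul, mul_assoc, abs_pow]
      gcongr
      calc |t| ^ k = (R + 1) ^ k * (|t| / (R + 1)) ^ k := by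
            rw [← mul_pow]; congr 1; field_simp
        _ ≤ _ := by
            gcongr
            exact (Nat.lt_succ_iff.mp (Finset.mem_range.mp hk)).trans hN
    · calc |f t| ≤ ‖f‖ := f.norm_coe_le_norm t
        _ = ‖f‖ * 1 := (mul_one _).symm
        _ ≤ _ := by gcongr; exact one_le_pow₀ hs
  have hall : ∀ t : ℝ, ∀ N, p.natDegree ≤ 2 * N →
      |p.eval t - f t| ≤ ε / 8 + K * (t ^ 2 / (R + 1) ^ 2) ^ N := by
    intro t N hN
    by_cases ht : R + 1 ≤ |t|
    · exact (hK t ht N hN).trans (by linarith)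
    · have := hp t ⟨by linarith [neg_abs_le t], by linarith [le_abs_self t]⟩
      have h2 : 0 ≤ K * (t ^ 2 / (R + 1) ^ 2) ^ N := by positivity
      linarith
  have hq1 : R ^ 2 / (R + 1) ^ 2 < 1 := by
    rw [div_lt_one (by positivity)]; nlinarith
  have hlim := (tendsto_pow_atTop_nhds_zero_of_lt_one (by positivity) hq1).const_mul K
  rw [mul_zero] at hlim
  obtain ⟨N, hN, hNd⟩ := ((hlim.eventually (gt_mem_nhds (by positivity : (0 : ℝ) < ε / 8))).and
    (eventually_ge_atTop p.natDegree)).exists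
  have hNd' : p.natDegree ≤ 2 * N := by omega
  have hform : ∀ ν : Measure ℝ, ∫ t, (t ^ 2 / (R + 1) ^ 2) ^ N ∂ν
      = (∫ t, t ^ (2 * N) ∂ν) / ((R + 1) ^ 2) ^ N := by
    intro ν
    simp only [div_pow, ← pow_mul]
    exact integral_div _ _
  have hformint : ∀ ν : Measure ℝ, (∀ k : ℕ, Integrable (fun t => t ^ k) ν) →
      Integrable (fun t => K * (t ^ 2 / (R + 1) ^ 2) ^ N) ν := by
    intro ν h
    have := ((h (2 * N)).div_const (((R + 1) ^ 2) ^ N)).const_mul K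
    simpa only [div_pow, ← pow_mul] using this
  have herr : ∀ ν : ProbabilityMeasure ℝ, (∀ k : ℕ, Integrable (fun t => t ^ k) (ν : Measure ℝ)) →
      |(∫ t, p.eval t ∂(ν : Measure ℝ)) - ∫ t, f t ∂(ν : Measure ℝ)|
        ≤ ε / 8 + K * ∫ t, (t ^ 2 / (R + 1) ^ 2) ^ N ∂(ν : Measure ℝ) := by
    intro ν h
    rw [← integral_sub (hpolyint h p) (f.integrable _)]
    calc _ ≤ ∫ t, |p.eval t - f t| ∂(ν : Measure ℝ) := abs_integral_le_integral_abs
      _ ≤ ∫ t, (ε / 8 + K * (t ^ 2 / (R + 1) ^ 2) ^ N) ∂(ν : Measure ℝ) := by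
          refine integral_mono ((hpolyint h p).sub (f.integrable _)).abs
            ((integrable_const _).add (hformint _ h)) fun t => hall t N hNd'
      _ = _ := by
          rw [integral_add (integrable_const _) (hformint _ h), integral_const_mul]
          simp
  have hμN : K * ∫ t, (t ^ 2 / (R + 1) ^ 2) ^ N ∂(μ : Measure ℝ) < ε / 8 := by
    refine lt_of_le_of_lt ?_ hN
    gcongr
    calc _ ≤ ∫ t, (R ^ 2 / (R + 1) ^ 2) ^ N ∂(μ : Measure ℝ) := by
          refine integral_mono_of_nonneg (ae_of_all _ fun t => by positivity)
            (integrable_const _) (hμ.mono fun t ht => ?_)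
          have : t ^ 2 ≤ R ^ 2 := sq_le_sq' (by linarith [neg_abs_le t]) (by linarith [le_abs_self t])
          dsimp only
          gcongr
      _ = _ := by simp
  have hconv : Tendsto (fun n => K * ∫ t, (t ^ 2 / (R + 1) ^ 2) ^ N ∂(μn n : Measure ℝ)) atTop
      (𝓝 (K * ∫ t, (t ^ 2 / (R + 1) ^ 2) ^ N ∂(μ : Measure ℝ))) := by
    simp only [hform]
    exact ((hmom (2 * N)).div_const _).const_mul K
  have hev := hconv.eventually (gt_mem_nhds hμN)
  have hev2 := (hpoly p).eventually (Metric.ball_mem_nhds _ (by positivity : (0 : ℝ) < ε / 8))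
  obtain ⟨n₀, hn₀⟩ := eventually_atTop.mp (hev.and (hev2.and hint))
  refine ⟨n₀, fun n hn => ?_⟩
  obtain ⟨h1, h2, h3⟩ := hn₀ n hn.le
  have e1 := herr μ hμint
  have e2 := herr (μn n) h3
  rw [Real.dist_eq] at h2
  rw [Real.dist_eq]
  rw [abs_lt] at h2 ⊢
  rw [abs_le] at e1 e2
  constructor <;> linarith

end Moments

/-! ### Symmetric measures and the squaring map -/

section SymmetricSquareRoot

open MeasureTheory

/-- The symmetric measure whose image under `t ↦ t ^ 2` is `ρ`, if `ρ` lives on `[0, ∞)`. -/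
noncomputable def symmetricSqrt (ρ : Measure ℝ) : Measure ℝ :=
  (2⁻¹ : ENNReal) • (ρ.map Real.sqrt + ρ.map fun t => -Real.sqrt t)

instance isProbabilityMeasure_symmetricSqrt (ρ : Measure ℝ) [IsProbabilityMeasure ρ] :
    IsProbabilityMeasure (symmetricSqrt ρ) := by
  have h1 : IsProbabilityMeasure (ρ.map Real.sqrt) :=
    Measure.isProbabilityMeasure_map (by fun_prop)
  have h2 : IsProbabilityMeasure (ρ.map fun t => -Real.sqrt t) :=
    Measure.isProbabilityMeasure_map (by fun_prop)
  constructor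
  rw [symmetricSqrt, Measure.smul_apply, Measure.add_apply, measure_univ, measure_univ,
    smul_eq_mul, one_add_one_eq_two]
  exact ENNReal.inv_mul_cancel (by norm_num) (by norm_num)

theorem isSymmetricMeasure_symmetricSqrt (ρ : Measure ℝ) :
    IsSymmetricMeasure (symmetricSqrt ρ) := by
  rw [IsSymmetricMeasure, symmetricSqrt, Measure.map_smul, Measure.map_add _ _ (by fun_prop),
    Measure.map_map (by fun_prop) (by fun_prop), Measure.map_map (by fun_prop) (by fun_prop),
    add_comm]
  congr 3
  funext t
  simp

theorem squarePushforward_symmetricSqrt {ρ : Measure ℝ} (hρ : ∀ᵐ t ∂ρ, 0 ≤ t) :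
    squarePushforward (symmetricSqrt ρ) = ρ := by
  have h : ∀ g : ℝ → ℝ, (∀ t, 0 ≤ t → g t = t) → ρ.map g = ρ := by
    intro g hg
    rw [Measure.map_congr (g := id) (hρ.mono fun t ht => hg t ht), Measure.map_id]
  rw [squarePushforward, symmetricSqrt, Measure.map_smul, Measure.map_add _ _ (by fun_prop),
    Measure.map_map (by fun_prop) (by fun_prop), Measure.map_map (by fun_prop) (by fun_prop),
    h _ fun t ht => by simp [Real.sq_sqrt ht], h _ fun t ht => by simp [Real.sq_sqrt ht],
    ← two_smul ENNReal ρ, smul_smul, ENNReal.inv_mul_cancel (by norm_num) (by norm_num), one_smul]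

/-- A symmetric measure is determined by its image under `t ↦ t ^ 2`. -/
theorem IsSymmetricMeasure.eq_symmetricSqrt {μ : Measure ℝ} (hμ : IsSymmetricMeasure μ) :
    μ = symmetricSqrt (squarePushforward μ) := by
  have h1 : (squarePushforward μ).map Real.sqrt = μ.map fun t => |t| := by
    rw [squarePushforward, Measure.map_map (by fun_prop) (by fun_prop)]
    congr 1
    funext t
    exact Real.sqrt_sq_eq_abs t
  have h2 : (squarePushforward μ).map (fun t => -Real.sqrt t) = μ.map fun t => -|t| := by
    rw [squarePushforward, Measure.map_map (by fun_prop) (by fun_prop)]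
    congr 1
    funext t
    exact congrArg Neg.neg (Real.sqrt_sq_eq_abs t)
  have h3 : (μ.map fun t => |t|) + (μ.map fun t => -|t|) = μ + μ := by
    have hm : Measurable fun t : ℝ => -|t| := by fun_prop
    -- One copy of `μ` becomes its reflection; then the claim holds pointwise, as `|t|, -|t|` are
    -- `t, -t` in some order.
    nth_rewrite 4 [← hμ]
    ext s hs
    rw [Measure.add_apply, Measure.add_apply, ← lintegral_indicator_one hs,
      ← lintegral_indicator_one hs, ← lintegral_indicator_one hs, ← lintegral_indicator_one hs,
      lintegral_map (measurable_one.indicator hs) (by fun_prop),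
      lintegral_map (measurable_one.indicator hs) hm,
      lintegral_map (measurable_one.indicator hs) (by fun_prop),
      ← lintegral_add_left (f := fun t => s.indicator 1 |t|)
        ((measurable_one.indicator hs).comp (by fun_prop)),
      ← lintegral_add_left (measurable_one.indicator hs)]
    congr 1
    funext t
    rcases abs_choice t with h | h
    · rw [h]
    · rw [h, neg_neg, add_comm]
  rw [symmetricSqrt, h1, h2, h3, ← two_smul ENNReal μ, smul_smul,
    ENNReal.inv_mul_cancel (by norm_num) (by norm_num), one_smul]

theorem integral_pow_even_of_squarePushforward {μ ρ : Measure ℝ}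
    (h : squarePushforward μ = ρ) (k : ℕ) : ∫ t, t ^ (2 * k) ∂μ = ∫ t, t ^ k ∂ρ := by
  rw [← h, squarePushforward, integral_map (by fun_prop) (by fun_prop)]
  simp only [pow_mul]

theorem IsSymmetricMeasure.integral_pow_odd {μ : Measure ℝ} (hμ : IsSymmetricMeasure μ) (k : ℕ) :
    ∫ t, t ^ (2 * k + 1) ∂μ = 0 := by
  have h : ∫ t, t ^ (2 * k + 1) ∂μ = ∫ t, (-t) ^ (2 * k + 1) ∂μ := by
    conv_lhs => rw [← hμ]
    rw [integral_map (by fun_prop) (by fun_prop)]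
  simp only [Odd.neg_pow (odd_two_mul_add_one k), integral_neg] at h
  linarith

end SymmetricSquareRoot

/-! ### Weak limits on a compact interval -/

section WeakLimit

open MeasureTheory Filter Topology

/-- A weak limit of probability measures on `[a, b]` lives on `[a, b]`, and integrals of all
continuous functions converge. -/
theorem tendsto_integral_of_ae_mem_Icc {ρn : ℕ → ProbabilityMeasure ℝ} {ρ : ProbabilityMeasure ℝ}
    (h : Tendsto ρn atTop (𝓝 ρ)) {a b : ℝ} (hab : a ≤ b)
    (hn : ∀ᶠ n in atTop, ∀ᵐ t ∂(ρn n : Measure ℝ), t ∈ Set.Icc a b) :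
    (∀ᵐ t ∂(ρ : Measure ℝ), t ∈ Set.Icc a b) ∧ ∀ f : ℝ → ℝ, Continuous f →
      Tendsto (fun n => ∫ t, f t ∂(ρn n : Measure ℝ)) atTop (𝓝 (∫ t, f t ∂(ρ : Measure ℝ))) := by
  have hρ : ∀ᵐ t ∂(ρ : Measure ℝ), t ∈ Set.Icc a b := by
    have h1 := ProbabilityMeasure.limsup_measure_closed_le_of_tendsto h
      (isClosed_Icc (a := a) (b := b))
    have h2 : ∀ᶠ n in atTop, (ρn n : Measure ℝ) (Set.Icc a b) = 1 :=
      hn.mono fun n hn => prob_compl_eq_zero_iff measurableSet_Icc |>.mp hn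
    rw [limsup_congr h2, limsup_const] at h1
    exact (prob_compl_eq_zero_iff measurableSet_Icc).mpr (le_antisymm prob_le_one h1)
  refine ⟨hρ, fun f hf => ?_⟩
  -- Weak convergence only tests bounded functions, so `f` is replaced by its composition with the
  -- projection onto `[a, b]`.
  let g : BoundedContinuousFunction ℝ ℝ :=
    (BoundedContinuousFunction.mkOfCompact ⟨fun t : Set.Icc a b => f t, by fun_prop⟩).compContinuous
      ⟨Set.projIcc a b hab, continuous_projIcc⟩
  have hg : ∀ t ∈ Set.Icc a b, g t = f t := fun t ht => by
    change f (Set.projIcc a b hab t) = f t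
    rw [Set.projIcc_of_mem hab ht]
  have hlim := (ProbabilityMeasure.tendsto_iff_forall_integral_tendsto.mp h) g
  rw [integral_congr_ae (hρ.mono hg)] at hlim
  exact hlim.congr' (hn.mono fun n hn => integral_congr_ae (hn.mono hg))

end WeakLimit

/-! ### Convergence of the moments of the Wigner matrix -/

section WignerMoments

open MeasureTheory Filter Topology

variable {A : Type*} [CStarAlgebra A] [PartialOrder A] [StarOrderedRing A] {φ : A →ₚ[ℂ] ℂ}
  {n : ℕ} {a : Fin n → Fin n → A} {C : ℝ}

theorem wigner_scale_le (hC : 0 ≤ C) (hn : 0 < n) : 1 / Real.sqrt n * C ≤ C := by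
  have h1 : 1 ≤ Real.sqrt n := Real.one_le_sqrt.mpr (by exact_mod_cast hn)
  exact mul_le_of_le_one_left hC ((div_le_one (by positivity)).mpr h1)

theorem card_mul_wigner_scale_sq (hn : 0 < n) (C : ℝ) :
    Fintype.card (Fin n) * (1 / Real.sqrt n * C) ^ 2 ≤ C ^ 2 := by
  have : (0 : ℝ) < n := by exact_mod_cast hn
  rw [Fintype.card_fin, mul_pow, div_pow, Real.sq_sqrt this.le]
  apply le_of_eq
  field_simp

theorem IsBooleanWignerFamily.wignerVariance_mem_Icc (hφ : φ 1 = 1)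
    (ha : IsBooleanWignerFamily φ.toLinearMap a) (hC : ∀ i j, j ≤ i → ‖a i j‖ ≤ C) (hn : 0 < n)
    (i : Fin n) : wignerVariance φ a i ∈ Set.Icc 0 (C ^ 2) := by
  refine ⟨wignerVariance_nonneg φ a i, ?_⟩
  have h := (ha.isBooleanMatrix hC).norm_sum_apply_le hφ (card_mul_wigner_scale_sq hn C) i
  rw [← ofReal_wignerVariance, Complex.norm_real] at h
  exact (le_abs_self _).trans h

theorem IsDistribution.ae_mem_Icc_of_diagonal {φ : A →ₗ[ℂ] ℂ} (hφ : φ 1 = 1) {d : Fin n → ℝ}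
    {μ : ProbabilityMeasure ℝ} (h : IsDistribution (trTensor n φ)
      (elemTensor (Matrix.diagonal fun i => (d i : ℂ)) (1 : A)) μ) {r s : ℝ} (hrs : r ≤ s)
    (hd : ∀ i, d i ∈ Set.Icc r s) : ∀ᵐ t ∂(μ : Measure ℝ), t ∈ Set.Icc r s := by
  -- The distance to the interval is a continuous test function that vanishes at every `d i`.
  let f : ℝ → ℝ := fun t => |t - Set.projIcc r s hrs t|
  have hf : Continuous f := by
    have := continuous_projIcc (h := hrs)
    fun_prop
  have h0 : ∫ t, f t ∂(μ : Measure ℝ) = 0 := by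
    rw [h.integral_eq_of_diagonal hφ f hf, Finset.sum_eq_zero, mul_zero]
    intro i _
    simp [f, Set.projIcc_of_mem hrs (hd i)]
  rw [integral_eq_zero_iff_of_nonneg (fun t => abs_nonneg _) (h f hf).1] at h0
  refine h0.mono fun t ht => ?_
  have : t = Set.projIcc r s hrs t := by
    simpa [f, sub_eq_zero] using ht
  rw [this]
  exact Subtype.coe_prop _

theorem IsDistribution.integral_pow_wignerMatrix {μ : ProbabilityMeasure ℝ}
    (h : IsDistribution (trTensor n φ.toLinearMap) (wignerMatrix a) μ) (k : ℕ) :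
    ((∫ t, t ^ k ∂(μ : Measure ℝ) : ℝ) : ℂ)
      = (n : ℂ)⁻¹ * ∑ i, φ ((wignerMatrix a ^ k) i i) :=
  h.integral_pow (isSelfAdjoint_wignerMatrix a) k

theorem norm_inv_mul_sum_le (hn : 0 < n) {f : Fin n → ℂ} {K : ℝ} (hf : ∀ i, ‖f i‖ ≤ K) :
    ‖(n : ℂ)⁻¹ * ∑ i, f i‖ ≤ K := by
  have : (0 : ℝ) < n := by exact_mod_cast hn
  rw [norm_mul, norm_inv, Complex.norm_natCast, inv_mul_le_iff₀ this]
  refine (norm_sum_le_of_le _ fun i _ => hf i).trans (le_of_eq ?_)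
  simp

end WignerMoments

-- The entrywise estimates are uniform in `i` and hence survive the normalized trace; with entries
-- of size `C / √n` the errors tend to zero.
open MeasureTheory Filter Topology in
theorem tendsto_integral_pow_wignerMatrix {A : Type*} [CStarAlgebra A] [PartialOrder A]
    [StarOrderedRing A] (φ : A →ₚ[ℂ] ℂ) (hφ : φ 1 = 1) (a : (n : ℕ) → Fin n → Fin n → A)
    (ha : ∀ n, IsBooleanWignerFamily φ.toLinearMap (a n)) {C : ℝ} (hC0 : 0 ≤ C)
    (hC : ∀ (n : ℕ) (i j : Fin n), j ≤ i → ‖a n i j‖ ≤ C)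
    {ρn μn : ℕ → ProbabilityMeasure ℝ} {m : ℕ → ℝ}
    (hρn : ∀ n, 0 < n → IsDistribution (trTensor n φ.toLinearMap)
      (elemTensor (Matrix.diagonal fun i => (wignerVariance φ (a n) i : ℂ)) (1 : A)) (ρn n))
    (hρ : ∀ k : ℕ, Tendsto (fun n => ∫ t, t ^ k ∂(ρn n : Measure ℝ)) atTop (𝓝 (m k)))
    (hμn : ∀ n, 0 < n →
      IsDistribution (trTensor n φ.toLinearMap) (wignerMatrix (a n)) (μn n)) (k : ℕ) :
    Tendsto (fun n => ∫ t, t ^ (2 * k) ∂(μn n : Measure ℝ)) atTop (𝓝 (m k)) ∧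
      Tendsto (fun n => ∫ t, t ^ (2 * k + 1) ∂(μn n : Measure ℝ)) atTop (𝓝 0) := by
  have hscale : ∀ K : ℝ, Tendsto (fun n : ℕ => K * (1 / Real.sqrt n * C)) atTop (𝓝 0) := by
    intro K
    have h1 : Tendsto (fun n : ℕ => 1 / Real.sqrt n) atTop (𝓝 0) := by
      simp only [one_div]
      exact tendsto_inv_atTop_zero.comp (Real.tendsto_sqrt_atTop.comp tendsto_natCast_atTop_atTop)
    simpa using (h1.mul_const C).const_mul K
  constructor
  · obtain ⟨K, hK⟩ := IsBooleanMatrix.exists_norm_apply_pow_even_sub_le C hC0 k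
    have hdiff : Tendsto (fun n => ∫ t, t ^ (2 * k) ∂(μn n : Measure ℝ)
        - ∫ t, t ^ k ∂(ρn n : Measure ℝ)) atTop (𝓝 0) := by
      refine squeeze_zero_norm' ((eventually_gt_atTop 0).mono fun n hn => ?_) (hscale K)
      rw [← Complex.norm_real, Complex.ofReal_sub, (hμn n hn).integral_pow_wignerMatrix,
        (hρn n hn).integral_eq_of_diagonal hφ (fun t => t ^ k) (by fun_prop)]
      push_cast
      rw [← mul_sub, ← Finset.sum_sub_distrib]
      refine norm_inv_mul_sum_le hn fun i => ?_
      rw [ofReal_wignerVariance]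
      exact hK ((ha n).isBooleanMatrix (hC n)) hφ (wigner_scale_le hC0 hn)
        (card_mul_wigner_scale_sq hn C) i
    simpa using hdiff.add (hρ k)
  · obtain ⟨K, hK⟩ := IsBooleanMatrix.exists_norm_apply_pow_odd_le C hC0 k
    refine squeeze_zero_norm' ((eventually_gt_atTop 0).mono fun n hn => ?_) (hscale K)
    rw [← Complex.norm_real, (hμn n hn).integral_pow_wignerMatrix]
    exact norm_inv_mul_sum_le hn fun i => hK ((ha n).isBooleanMatrix (hC n)) hφ
      (wigner_scale_le hC0 hn) (card_mul_wigner_scale_sq hn C) i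

theorem mainTheorem12 {A : Type*} [CStarAlgebra A] [PartialOrder A] [StarOrderedRing A]
    (φ : A →ₚ[ℂ] ℂ) (hφ : φ 1 = 1)
    (a : (n : ℕ) → Fin n → Fin n → A)
    (ha : ∀ n, IsBooleanWignerFamily φ.toLinearMap (a n))
    (C : ℝ) (hC : ∀ (n : ℕ) (i j : Fin n), j ≤ i → ‖a n i j‖ ≤ C)
    (ρn : ℕ → MeasureTheory.ProbabilityMeasure ℝ) (ρ : MeasureTheory.ProbabilityMeasure ℝ)
    (hρn : ∀ n, 0 < n → IsDistribution (trTensor n φ.toLinearMap)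
      (elemTensor (varianceMap φ.toLinearMap (wignerMatrix (a n)) 1) (1 : A)) (ρn n))
    (hρ : Filter.Tendsto ρn Filter.atTop (nhds ρ)) :
    ∃ μ : MeasureTheory.ProbabilityMeasure ℝ,
      (IsSymmetricMeasure (μ : MeasureTheory.Measure ℝ) ∧
        squarePushforward (μ : MeasureTheory.Measure ℝ) = (ρ : MeasureTheory.Measure ℝ)) ∧
      (∀ μ' : MeasureTheory.Measure ℝ, IsSymmetricMeasure μ' →
        squarePushforward μ' = (ρ : MeasureTheory.Measure ℝ) →
          μ' = (μ : MeasureTheory.Measure ℝ)) ∧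
      ∃ μn : ℕ → MeasureTheory.ProbabilityMeasure ℝ,
        (∀ n, 0 < n →
          IsDistribution (trTensor n φ.toLinearMap) (wignerMatrix (a n)) (μn n)) ∧
        Filter.Tendsto μn Filter.atTop (nhds μ) := by
  have hC0 : 0 ≤ C := (norm_nonneg _).trans (hC 1 0 0 le_rfl)
  have hρd : ∀ n, 0 < n → IsDistribution (trTensor n φ.toLinearMap)
      (elemTensor (Matrix.diagonal fun i => (wignerVariance φ (a n) i : ℂ)) (1 : A)) (ρn n) := by
    intro n hn
    rw [← (ha n).varianceMap_one (hC n)]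
    exact hρn n hn
  obtain ⟨hρae, hρint⟩ := tendsto_integral_of_ae_mem_Icc hρ (sq_nonneg C)
    ((Filter.eventually_gt_atTop 0).mono fun n hn => (hρd n hn).ae_mem_Icc_of_diagonal hφ
      (sq_nonneg C) fun i => (ha n).wignerVariance_mem_Icc hφ (hC n) hn i)
  have hex : ∀ n, ∃ ν : MeasureTheory.ProbabilityMeasure ℝ,
      0 < n → IsDistribution (trTensor n φ.toLinearMap) (wignerMatrix (a n)) ν := by
    intro n
    rcases Nat.eq_zero_or_pos n with rfl | hn
    · exact ⟨ρ, fun h => absurd h (lt_irrefl 0)⟩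
    · obtain ⟨ν, hν⟩ := exists_isDistribution (trTensor n φ.toLinearMap)
        (trTensor_star_mul_self_nonneg φ) (trTensor_one hn hφ) (isSelfAdjoint_wignerMatrix (a n))
      exact ⟨ν, fun _ => hν⟩
  choose μn hμn using hex
  let μ : MeasureTheory.ProbabilityMeasure ℝ :=
    ⟨symmetricSqrt ρ, isProbabilityMeasure_symmetricSqrt ρ⟩
  have hsymm : IsSymmetricMeasure (μ : MeasureTheory.Measure ℝ) :=
    isSymmetricMeasure_symmetricSqrt ρ
  have hsq : squarePushforward (μ : MeasureTheory.Measure ℝ) = ρ :=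
    squarePushforward_symmetricSqrt (hρae.mono fun t ht => ht.1)
  refine ⟨μ, ⟨hsymm, hsq⟩, fun μ' h1 h2 => ?_, μn, hμn, ?_⟩
  · rw [h1.eq_symmetricSqrt, h2]
    rfl
  · refine tendsto_of_moments hC0 ?_ ((Filter.eventually_gt_atTop 0).mono fun n hn k =>
      (hμn n hn (fun t => t ^ k) (by fun_prop)).1) fun k => ?_
    -- The support of `ρ` in `[0, C ^ 2]`, pulled back along the square, puts `μ` on `[-C, C]`.
    · have h : ∀ᵐ s ∂(squarePushforward (μ : MeasureTheory.Measure ℝ)), s ∈ Set.Icc 0 (C ^ 2) := by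
        rw [hsq]; exact hρae
      refine (MeasureTheory.ae_of_ae_map (by fun_prop) h).mono fun t ht => ?_
      exact abs_le_of_sq_le_sq ht.2 hC0
    · have h := tendsto_integral_pow_wignerMatrix φ hφ a ha hC0 hC hρd
        (fun k => hρint (fun t => t ^ k) (by fun_prop)) hμn
      rcases Nat.even_or_odd' k with ⟨j, rfl | rfl⟩
      · rw [integral_pow_even_of_squarePushforward hsq]
        exact (h j).1
      · rw [hsymm.integral_pow_odd]
        exact (h j).2
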